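/- Let $R=\mathbb{C}[s,t,u]$ with its standard grading, and let $a,b,c,d\in R$ be homogeneous polynomials of the same degree $n$ (the zero polynomial being allowed) with $\gcd(a,b,c,d)=1$. Set $I=\langle a,b,c,d\rangle\subset R$ and let $\mathrm{Syz}(a,b,c,d)=\{(A,B,C,D)\in R^4 : Aa+Bb+Cc+Dd=0\}$, graded as a submodule of $R^4$. Suppose that $a,b,c,d$ have at least one common zero in $\mathbb{P}^2(\mathbb{C})$. Then the following are equivalent: 1. $\mathrm{Syz}(a,b,c,d)$ is a graded free $R$-module, that is, it has an $R$-basis consisting of homogeneous vectors (vectors whose four entries are homogeneous polynomials of one common degree). 2. The $R$-module $R/I$ has projective dimension $2$. 3. The ring $R/I$ is Cohen–Macaulay, that is, it is Noetherian and for every maximal ideal $P$ of $R/I$, the supremum of the lengths of the regular sequences contained in $P$ is equal to the height of $P$. 4. The ideal $\langle s,t,u\rangle$ is not an associated prime of the $R$-module $R/I$. 5. $I$ is saturated with respect to $\langle s,t,u\rangle$, that is, every $f\in R$ with $\langle s,t,u\rangle^e f\subset I$ for some $e\ge 0$ lies in $I$. -/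

import Mathlib

noncomputable section

/-- The syzygy module of `f 0, …, f (m - 1)`: all vectors `A` of ring elements with
`∑ i, A i * f i = 0`. -/
def Syz {R : Type*} [CommRing R] {m : ℕ} (f : Fin m → R) : Submodule R (Fin m → R) :=
  LinearMap.ker (Fintype.linearCombination R f)

theorem mem_Syz {R : Type*} [CommRing R] {m : ℕ} (f A : Fin m → R) :
    A ∈ Syz f ↔ ∑ i, A i * f i = 0 := by
  simp [Syz, Fintype.linearCombination_apply]

/-- A submodule `N` of the graded free module `k[x₁,…,x_r]^m` is graded free if it is free on a
basis of homogeneous vectors; a vector is homogeneous of degree `e` if all of its entries are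
homogeneous polynomials of degree `e`. -/
def IsGradedFree {k : Type*} [Field k] {r m : ℕ}
    (N : Submodule (MvPolynomial (Fin r) k) (Fin m → MvPolynomial (Fin r) k)) : Prop :=
  ∃ (κ : Type) (B : Module.Basis κ (MvPolynomial (Fin r) k) N) (deg : κ → ℕ),
    ∀ (i : κ) (j : Fin m), ((B i : Fin m → MvPolynomial (Fin r) k) j).IsHomogeneous (deg i)

/-- The homogeneous maximal ideal `⟨x₁,…,x_r⟩` of `k[x₁,…,x_r]`. -/
def irrelevantIdeal (k : Type*) [Field k] (r : ℕ) : Ideal (MvPolynomial (Fin r) k) :=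
  Ideal.span (Set.range MvPolynomial.X)

/-- An ideal `I` of `k[x₁,…,x_r]` is saturated if it contains its saturation `I : 𝔪^∞` with respect
to `𝔪 = ⟨x₁,…,x_r⟩`, that is, every `f` with `𝔪 ^ e * f ⊆ I` for some `e`. -/
def IsSaturated {k : Type*} [Field k] {r : ℕ} (I : Ideal (MvPolynomial (Fin r) k)) : Prop :=
  ∀ f : MvPolynomial (Fin r) k,
    (∃ e : ℕ, ∀ g ∈ irrelevantIdeal k r ^ e, g * f ∈ I) → f ∈ I

/-- The depth (grade) of a ring `A` at an ideal `P`: the supremum of the lengths of the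
`A`-regular sequences whose elements lie in `P`. -/
def idealDepth {A : Type*} [CommRing A] (P : Ideal A) : ℕ∞ :=
  ⨆ (rs : List A) (_ : RingTheory.Sequence.IsRegular A rs) (_ : ∀ x ∈ rs, x ∈ P),
    (rs.length : ℕ∞)

/-- A ring is Cohen–Macaulay if it is Noetherian and the depth of every maximal ideal is equal to
its codimension (height). -/
structure IsCohenMacaulay (A : Type*) [CommRing A] : Prop where
  noetherian : IsNoetherianRing A
  depth_eq : ∀ P : Ideal A, P.IsMaximal → idealDepth P = P.height

end

/-! Everything is compared with one condition: no element outside `I` is multiplied into `I` by all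
three variables. This restates 4 (the ideal `𝔪` of the variables is maximal) and 5 (peel off one
power of `𝔪` at a time).

The syzygy module is the kernel of `φ : R^4 → R`, whose image is `I`. Diagram chases with the Koszul
relations show that the variables form a weakly regular sequence on `ker φ` when the condition holds
(`ker_of_mem_range`), and that the condition holds when they do (`mem_range_of_ker`). A finite
projective module inherits the sequence from `R`. Conversely, on a graded submodule it makes any
homogeneous lift of a basis of `N / 𝔪N` an `R`-basis (`isGradedFree_of_isWeaklyRegularTriple`). Thus
projective syzygies are graded free without the Quillen–Suslin theorem.

Dimension shifting links projective syzygies to projective dimension at most 2. Smaller values are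
excluded because a projective ideal without common factor is the unit ideal, whereas `I` has a zero.

For Cohen–Macaulayness, coprimality bounds all heights in `R/I` by 1, so a regular element in each
maximal ideal suffices. Away from the origin homogeneity supplies one; at the origin it is condition
4. Conversely, the line over the common zero forces height, hence depth, at least 1 at the origin.
-/

noncomputable section

open MvPolynomial

/-! ### Weakly regular triples and Koszul relations -/

/-- The elements `x, y, z` form a weakly regular sequence on `N`, spelled out elementwise. -/
structure IsWeaklyRegularTriple {R : Type*} [CommRing R] (x y z : R) (N : Type*) [AddCommGroup N]
    [Module R N] : Prop where
  first : ∀ v : N, x • v = 0 → v = 0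
  second : ∀ v w : N, y • v = x • w → ∃ a : N, v = x • a
  third : ∀ v w w' : N, z • v = x • w + y • w' → ∃ a b : N, v = x • a + y • b

namespace IsWeaklyRegularTriple

variable {R : Type*} [CommRing R] {x y z : R} {N F Q : Type*} [AddCommGroup N] [Module R N]
  [AddCommGroup F] [Module R F] [AddCommGroup Q] [Module R Q]

theorem smul_left_cancel (h : IsWeaklyRegularTriple x y z N) {v w : N} (e : x • v = x • w) :
    v = w :=
  sub_eq_zero.1 (h.first _ (by rw [smul_sub, e, sub_self]))

theorem of_retract (h : IsWeaklyRegularTriple x y z F) (i : N →ₗ[R] F) (p : F →ₗ[R] N)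
    (hpi : p ∘ₗ i = .id) : IsWeaklyRegularTriple x y z N := by
  have hp (v : N) : p (i v) = v := LinearMap.congr_fun hpi v
  refine ⟨fun v e => ?_, fun v w e => ?_, fun v w w' e => ?_⟩
  · rw [← hp v, h.first (i v) (by rw [← map_smul, e, map_zero]), map_zero]
  · obtain ⟨a, ha⟩ := h.second (i v) (i w) (by rw [← map_smul, e, map_smul])
    exact ⟨p a, by rw [← map_smul, ← ha, hp]⟩
  · obtain ⟨a, b, hab⟩ := h.third (i v) (i w) (i w') (by rw [← map_smul, e]; simp)
    exact ⟨p a, p b, by rw [← map_smul, ← map_smul, ← map_add, ← hab, hp]⟩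

theorem pi (h : IsWeaklyRegularTriple x y z N) (ι : Type*) :
    IsWeaklyRegularTriple x y z (ι → N) := by
  refine ⟨fun v e => ?_, fun v w e => ?_, fun v w w' e => ?_⟩
  · exact funext fun j => h.first _ (congrFun e j)
  · choose a ha using fun j => h.second (v j) (w j) (congrFun e j)
    exact ⟨a, funext ha⟩
  · choose a b hab using fun j => h.third (v j) (w j) (w' j) (congrFun e j)
    exact ⟨a, b, funext hab⟩

theorem of_projective (h : IsWeaklyRegularTriple x y z R) [Module.Finite R N]
    [Module.Projective R N] : IsWeaklyRegularTriple x y z N := by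
  obtain ⟨n, f, g, -, -, hfg⟩ := Module.Finite.exists_comp_eq_id_of_projective R N
  exact (h.pi (Fin n)).of_retract g f hfg

/-- Exactness of the Koszul complex of a weakly regular triple in degree one. -/
theorem koszul_exact (h : IsWeaklyRegularTriple x y z N) {a b c : N}
    (e : z • a - y • b + x • c = 0) :
    ∃ p q r : N, a = y • p - x • q ∧ b = z • p - x • r ∧ c = z • q - y • r := by
  obtain ⟨a₁, a₂, ha⟩ := h.third a (-c) b (by
    rw [← sub_eq_zero, ← e]; module)
  obtain ⟨b₁, hb⟩ := h.second (b - z • a₂) (z • a₁ + c) (by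
    rw [← sub_eq_zero, ← neg_eq_zero, ← e, ha]; module)
  refine ⟨a₂, -a₁, -b₁, by rw [ha]; module, ?_, ?_⟩
  · rw [eq_add_of_sub_eq hb]; module
  · apply h.smul_left_cancel
    have hb' := eq_add_of_sub_eq hb
    rw [← sub_eq_zero, ← e, ha, hb']; module

/-- Lifts `α, β, γ` of `x • f, y • f, z • f` have Koszul differences in the kernel, and these form a
cycle. Exactness there yields corrections `p, q` in the kernel with `y • (α - p) = x • (β - q)`.
Then `α - p = x • w`, and cancelling `x` in `Q` makes `w` a lift of `f`. -/
theorem mem_range_of_ker {φ : F →ₗ[R] Q} (hF : IsWeaklyRegularTriple x y z F)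
    (hK : IsWeaklyRegularTriple x y z (LinearMap.ker φ)) (hQ : ∀ q : Q, x • q = 0 → q = 0) {f : Q}
    (hx : x • f ∈ LinearMap.range φ) (hy : y • f ∈ LinearMap.range φ)
    (hz : z • f ∈ LinearMap.range φ) : f ∈ LinearMap.range φ := by
  obtain ⟨α, hα⟩ := hx
  obtain ⟨β, hβ⟩ := hy
  obtain ⟨γ, hγ⟩ := hz
  let a : LinearMap.ker φ := ⟨y • α - x • β, by simp [hα, hβ, smul_comm x y]⟩
  let b : LinearMap.ker φ := ⟨z • α - x • γ, by simp [hα, hγ, smul_comm x z]⟩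
  let c : LinearMap.ker φ := ⟨z • β - y • γ, by simp [hβ, hγ, smul_comm y z]⟩
  obtain ⟨p, q, r, hp, -, -⟩ := hK.koszul_exact (a := a) (b := b) (c := c) (by
    apply Subtype.ext
    simp only [a, b, c, Submodule.coe_add, Submodule.coe_sub, Submodule.coe_smul, Submodule.coe_zero]
    module)
  have hp' : y • α - x • β = y • (p : F) - x • (q : F) := congrArg Subtype.val hp
  obtain ⟨w, hw⟩ := hF.second (α - p) (β - q) (by
    rw [← sub_eq_zero, ← sub_eq_zero.2 hp']; module)
  refine ⟨w, sub_eq_zero.1 (hQ _ ?_)⟩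
  rw [smul_sub, ← map_smul, ← hw, map_sub, hα, p.2]
  simp

/-- Only the third condition needs saturation. If `v = x • α + y • β`, then `φ α = -(y • g)` and `φ
β = x • g` for some `g`; the given relation puts `z • g` in the range too. A lift `γ` of `g` moves
both coefficients into the kernel without changing `v`. -/
theorem ker_of_mem_range {φ : F →ₗ[R] Q} (hF : IsWeaklyRegularTriple x y z F)
    (hQ : IsWeaklyRegularTriple x y z Q)
    (hsat : ∀ f : Q, x • f ∈ LinearMap.range φ → y • f ∈ LinearMap.range φ →
      z • f ∈ LinearMap.range φ → f ∈ LinearMap.range φ) :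
    IsWeaklyRegularTriple x y z (LinearMap.ker φ) := by
  refine ⟨fun v e => ?_, fun v w e => ?_, fun v w w' e => ?_⟩
  · exact Subtype.ext (hF.first _ (congrArg Subtype.val e))
  · obtain ⟨a, ha⟩ := hF.second v w (congrArg Subtype.val e)
    refine ⟨⟨a, hQ.first _ ?_⟩, Subtype.ext ha⟩
    rw [← map_smul, ← ha, v.2]
  · have e' : z • (v : F) = x • (w : F) + y • (w' : F) := congrArg Subtype.val e
    obtain ⟨α, β, hv⟩ := hF.third v w w' e'
    have h₀ : x • φ α + y • φ β = 0 := by rw [← map_smul, ← map_smul, ← map_add, ← hv, v.2]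
    obtain ⟨g, hg⟩ := hQ.second (φ β) (-φ α) (by rw [← sub_eq_zero, ← h₀]; module)
    have hα : φ α = -(y • g) := by
      apply hQ.smul_left_cancel
      rw [hg] at h₀
      rw [← sub_eq_zero, ← h₀]; module
    obtain ⟨δ, hδ⟩ := hF.second (z • β - w') (w - z • α) (by
      rw [hv] at e'
      rw [← sub_eq_zero, ← sub_eq_zero.2 e']; module)
    have hzg : z • g = φ δ := by
      apply hQ.smul_left_cancel
      rw [← map_smul, ← hδ, map_sub, map_smul, w'.2, hg, sub_zero, smul_comm]
    obtain ⟨γ, hγ⟩ := hsat g ⟨β, hg⟩ ⟨-α, by rw [map_neg, hα, neg_neg]⟩ ⟨δ, hzg.symm⟩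
    refine ⟨⟨α + y • γ, ?_⟩, ⟨β - x • γ, ?_⟩, Subtype.ext ?_⟩
    · rw [LinearMap.mem_ker, map_add, map_smul, hγ, hα, neg_add_cancel]
    · rw [LinearMap.mem_ker, map_sub, map_smul, hγ, hg, sub_self]
    · simp only [Submodule.coe_add, Submodule.coe_smul]
      rw [hv]; module

end IsWeaklyRegularTriple

/-! ### Ideals generated by variables -/

namespace MvPolynomial

variable {σ k : Type*} [CommRing k]

theorem mem_span_X_image_of_X_mul_mem {s : Set σ} {j : σ} (hj : j ∉ s) {p : MvPolynomial σ k}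
    (h : X j * p ∈ Ideal.span (X '' s : Set (MvPolynomial σ k))) :
    p ∈ Ideal.span (X '' s : Set (MvPolynomial σ k)) := by
  classical
  rw [mem_ideal_span_X_image] at h ⊢
  intro m hm
  obtain ⟨i, hi, hmi⟩ := h (Finsupp.single j 1 + m) (by
    rw [mem_support_iff, coeff_X_mul]; exact mem_support_iff.1 hm)
  refine ⟨i, hi, ?_⟩
  have hij : i ≠ j := fun e => hj (e ▸ hi)
  rwa [Finsupp.add_apply, Finsupp.single_eq_of_ne hij, zero_add] at hmi

/-- A monomial `m` is not divisible by `X j ^ (m j + 1)`, so at this power it must be divisible by a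
variable from `s`. -/
theorem mem_span_X_image_of_forall_pow {s : Set σ} {j : σ} {p : MvPolynomial σ k}
    (h : ∀ n : ℕ, p ∈ Ideal.span (X '' s : Set (MvPolynomial σ k)) ⊔ Ideal.span {X j} ^ n) :
    p ∈ Ideal.span (X '' s : Set (MvPolynomial σ k)) := by
  classical
  rw [mem_ideal_span_X_image]
  intro m hm
  have key : Ideal.span (X '' s : Set (MvPolynomial σ k)) ⊔ Ideal.span {X j} ^ (m j + 1) =
      Ideal.span ((fun t => monomial t (1 : k)) ''
        ((fun i => Finsupp.single i 1) '' s ∪ {Finsupp.single j (m j + 1)})) := by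
    rw [Ideal.span_singleton_pow, ← Ideal.span_union, Set.image_union, Set.image_image,
      Set.image_singleton, X_pow_eq_monomial]
    rfl
  have h' := h (m j + 1)
  rw [key, mem_ideal_span_monomial_image] at h'
  obtain ⟨t, ht, htm⟩ := h' m hm
  rcases ht with ⟨i, hi, rfl⟩ | rfl
  · refine ⟨i, hi, fun e => ?_⟩
    have := htm i
    simp [e] at this
  · have := htm j
    simp at this

end MvPolynomial

theorem isWeaklyRegularTriple_X (k : Type*) [Field k] :
    IsWeaklyRegularTriple (X 0 : MvPolynomial (Fin 3) k) (X 1) (X 2) (MvPolynomial (Fin 3) k) := by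
  refine ⟨fun v e => ?_, fun v w e => ?_, fun v w w' e => ?_⟩
  · simpa [X_ne_zero] using e
  · have := mem_span_X_image_of_X_mul_mem (s := {(0 : Fin 3)}) (j := 1) (p := v) (by simp) (by
      rw [Set.image_singleton, Ideal.mem_span_singleton]; exact ⟨w, e⟩)
    rwa [Set.image_singleton, Ideal.mem_span_singleton] at this
  · have := mem_span_X_image_of_X_mul_mem (s := {(0 : Fin 3), 1}) (j := 2) (p := v)
      (by simp) (by
        rw [Set.image_pair, Ideal.mem_span_pair]
        exact ⟨w, w', by rw [← smul_eq_mul (X 2), e]; simp only [smul_eq_mul]; ring⟩)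
    rw [Set.image_pair, Ideal.mem_span_pair] at this
    obtain ⟨a, b, hab⟩ := this
    exact ⟨a, b, by rw [← hab]; simp only [smul_eq_mul]; ring⟩

/-! ### Lifting linear independence along a regular sequence -/

open scoped Pointwise in
/-- If a family is linearly independent modulo `J + (x)` and `x` is regular on `N / J N`, then it is
linearly independent modulo `J`, as long as `J` is closed for the `x`-adic topology. -/
theorem mem_of_linearCombination_mem_smul_top {R N ι : Type*} [CommRing R] [AddCommGroup N]
    [Module R N] {J : Ideal R} {x : R} {g : ι → N}
    (hreg : ∀ v : N, x • v ∈ J • (⊤ : Submodule R N) → v ∈ J • (⊤ : Submodule R N))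
    (hJ : ∀ r, (∀ n : ℕ, r ∈ J ⊔ Ideal.span {x} ^ n) → r ∈ J)
    (hg : ∀ c : ι →₀ R, Finsupp.linearCombination R g c ∈ (J ⊔ Ideal.span {x}) • (⊤ : Submodule R N) →
      ∀ i, c i ∈ J ⊔ Ideal.span {x})
    (c : ι →₀ R) (hc : Finsupp.linearCombination R g c ∈ J • (⊤ : Submodule R N)) (i : ι) :
    c i ∈ J := by
  classical
  suffices H : ∀ (n : ℕ) (c : ι →₀ R), Finsupp.linearCombination R g c ∈ J • (⊤ : Submodule R N) →
      ∀ i, c i ∈ J ⊔ Ideal.span {x} ^ n from hJ _ fun n => H n c hc i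
  intro n
  induction n with
  | zero => intro c _ i; simp
  | succ n ih =>
    intro c hc i
    -- The clause `r = 0 → d = 0` keeps the support finite when the quotients are taken
    -- coefficientwise.
    have hdiv : ∀ r : R, ∃ d : R, (r = 0 → d = 0) ∧ (r ∈ J ⊔ Ideal.span {x} → r - x * d ∈ J) := by
      intro r
      by_cases hr : r ∈ J ⊔ Ideal.span {x} ∧ r ≠ 0
      · obtain ⟨a, ha, b, hb, hab⟩ := Submodule.mem_sup.1 hr.1
        obtain ⟨d, rfl⟩ := Ideal.mem_span_singleton'.1 hb
        exact ⟨d, fun h => absurd h hr.2, fun _ => by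
          rw [← hab, mul_comm x d, add_sub_cancel_right]; exact ha⟩
      · refine ⟨0, fun _ => rfl, fun h => ?_⟩
        have : r = 0 := by by_contra h0; exact hr ⟨h, h0⟩
        simp [this]
    choose D hD₀ hD using hdiv
    have hmem := hg c (Submodule.smul_mono_left le_sup_left hc)
    let d : ι →₀ R := c.mapRange D (hD₀ 0 rfl)
    have hdJ : ∀ i, (c - x • d) i ∈ J := fun i => hD _ (hmem i)
    -- As `c ≡ x • d` modulo `J`, the combination with coefficients `d` lies in `J N` after
    -- cancelling `x`; each round gains one power of `x`.
    have hd := ih d (hreg _ (by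
      have h₁ : Finsupp.linearCombination R g (c - x • d) ∈ J • (⊤ : Submodule R N) := by
        rw [Finsupp.linearCombination_apply]
        exact Submodule.sum_mem _ fun i _ => Submodule.smul_mem_smul (hdJ i) trivial
      rw [map_sub, map_smul] at h₁
      simpa using Submodule.sub_mem _ hc h₁)) i
    have e : c i = (c - x • d) i + x * d i := by simp
    rw [e]
    obtain ⟨a, ha, b, hb, hab⟩ := Submodule.mem_sup.1 hd
    rw [← hab, mul_add, ← add_assoc]
    refine Submodule.add_mem_sup (J.add_mem (hdJ i) (J.mul_mem_left x ha)) ?_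
    rw [pow_succ']
    exact Ideal.mul_mem_mul (Ideal.mem_span_singleton_self x) hb

/-! ### Homogeneous components and the irrelevant ideal -/

namespace MvPolynomial

variable {σ k : Type*} [CommRing k]

theorem homogeneousComponent_add_mul {p q : MvPolynomial σ k} {n : ℕ} (hp : p.IsHomogeneous n)
    (e : ℕ) : homogeneousComponent (e + n) (q * p) = homogeneousComponent e q * p := by
  conv_lhs => rw [← sum_homogeneousComponent q]
  rw [Finset.sum_mul, map_sum]
  have h (i : ℕ) : homogeneousComponent (e + n) (homogeneousComponent i q * p) =
      if e = i then homogeneousComponent i q * p else 0 := by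
    rw [homogeneousComponent_of_mem (n := i + n)
      ((homogeneousComponent_isHomogeneous i q).mul hp)]
    simp
  simp_rw [h]
  rw [Finset.sum_ite_eq]
  split_ifs with he
  · rfl
  · rw [homogeneousComponent_eq_zero, zero_mul]
    simpa using he

theorem homogeneousComponent_succ_X_mul (i : σ) (p : MvPolynomial σ k) (e : ℕ) :
    homogeneousComponent (e + 1) (X i * p) = X i * homogeneousComponent e p := by
  rw [mul_comm, homogeneousComponent_add_mul (isHomogeneous_X k i), mul_comm]

theorem homogeneousComponent_zero_X_mul (i : σ) (p : MvPolynomial σ k) :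
    homogeneousComponent 0 (X i * p) = 0 := by
  rw [homogeneousComponent_zero, ← constantCoeff_eq]
  simp

end MvPolynomial

theorem irrelevantIdeal_eq_ker (k : Type*) [Field k] (r : ℕ) :
    irrelevantIdeal k r = RingHom.ker (constantCoeff : MvPolynomial (Fin r) k →+* k) := by
  have h : irrelevantIdeal k r = Ideal.span (X '' (Set.univ : Set (Fin r))) := by
    rw [Set.image_univ]; rfl
  ext p
  rw [h, mem_ideal_span_X_image, RingHom.mem_ker, constantCoeff_eq]
  constructor
  · intro hp
    by_contra h0
    obtain ⟨i, -, hi⟩ := hp 0 (mem_support_iff.2 h0)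
    exact hi rfl
  · intro h0 m hm
    by_contra! hcon
    have : m = 0 := Finsupp.ext fun i => hcon i trivial
    exact mem_support_iff.1 hm (this ▸ h0)

instance (k : Type*) [Field k] (r : ℕ) : (irrelevantIdeal k r).IsMaximal := by
  rw [irrelevantIdeal_eq_ker]
  exact RingHom.ker_isMaximal_of_surjective _ fun c => ⟨C c, constantCoeff_C _ c⟩

theorem sub_C_constantCoeff_mem_irrelevantIdeal {k : Type*} [Field k] {r : ℕ}
    (p : MvPolynomial (Fin r) k) : p - C (constantCoeff p) ∈ irrelevantIdeal k r := by
  rw [irrelevantIdeal_eq_ker, RingHom.mem_ker]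
  simp

theorem X_mem_irrelevantIdeal {k : Type*} [Field k] {r : ℕ} (i : Fin r) :
    X i ∈ irrelevantIdeal k r :=
  Ideal.subset_span ⟨i, rfl⟩

theorem irrelevantIdeal_three (k : Type*) [Field k] :
    irrelevantIdeal k 3 = Ideal.span {X 0, X 1} ⊔ Ideal.span {X 2} := by
  rw [irrelevantIdeal, ← Ideal.span_union]
  congr 1
  ext p
  simp only [Set.mem_range, Fin.exists_fin_succ, Set.mem_union, Set.mem_insert_iff,
    Set.mem_singleton_iff, IsEmpty.exists_iff, or_false, eq_comm (a := p)]
  exact or_assoc.symm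

section Graded

variable {k : Type} [Field k] {r m : ℕ}

/-- The homogeneous component of degree `e` of a vector of polynomials. -/
def vectorComponent (k : Type) [Field k] (r m e : ℕ) :
    (Fin m → MvPolynomial (Fin r) k) →ₗ[k] (Fin m → MvPolynomial (Fin r) k) :=
  (homogeneousComponent e).compLeft (Fin m)

theorem vectorComponent_apply (e : ℕ) (v : Fin m → MvPolynomial (Fin r) k) (j : Fin m) :
    vectorComponent k r m e v j = homogeneousComponent e (v j) := rfl

theorem exists_sum_vectorComponent (v : Fin m → MvPolynomial (Fin r) k) :
    ∃ n : ℕ, ∑ e ∈ Finset.range n, vectorComponent k r m e v = v := by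
  refine ⟨Finset.univ.sup (fun j => (v j).totalDegree) + 1, funext fun j => ?_⟩
  rw [Finset.sum_apply]
  simp_rw [vectorComponent_apply]
  conv_rhs => rw [← sum_homogeneousComponent (v j)]
  symm
  refine Finset.sum_subset ?_ fun e _ he => ?_
  · intro e
    have := Finset.le_sup (f := fun j => (v j).totalDegree) (Finset.mem_univ j)
    simp only [Finset.mem_range]; omega
  · exact homogeneousComponent_eq_zero _ _ (by simpa using he)

/-- A submodule of a free module is graded if it contains the homogeneous components of its
elements. -/
def IsGradedSubmodule (N : Submodule (MvPolynomial (Fin r) k) (Fin m → MvPolynomial (Fin r) k)) :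
    Prop :=
  ∀ v ∈ N, ∀ e, vectorComponent k r m e v ∈ N

theorem isGradedSubmodule_Syz {f : Fin m → MvPolynomial (Fin r) k} {n : ℕ}
    (hf : ∀ i, (f i).IsHomogeneous n) : IsGradedSubmodule (Syz f) := by
  intro v hv e
  rw [mem_Syz] at hv ⊢
  have := congrArg (homogeneousComponent (e + n)) hv
  rw [map_sum, map_zero] at this
  simp_rw [homogeneousComponent_add_mul (hf _)] at this
  exact this

end Graded

open scoped Pointwise in
theorem Submodule.mem_span_pair_smul_top {R N : Type*} [CommRing R] [AddCommGroup N] [Module R N]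
    {x y : R} {v : N} :
    v ∈ Ideal.span {x, y} • (⊤ : Submodule R N) ↔ ∃ a b : N, v = x • a + y • b := by
  rw [Ideal.span_insert, Submodule.sup_smul, Submodule.mem_sup]
  simp only [Submodule.ideal_span_singleton_smul, Submodule.mem_smul_pointwise_iff_exists]
  constructor
  · rintro ⟨_, ⟨a, -, rfl⟩, _, ⟨b, -, rfl⟩, rfl⟩
    exact ⟨a, b, rfl⟩
  · rintro ⟨a, b, rfl⟩
    exact ⟨_, ⟨a, trivial, rfl⟩, _, ⟨b, trivial, rfl⟩, rfl⟩

/-- The variables are removed one by one, descending from independence modulo `𝔪` through `(X 0, X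
1)` and `(X 0)` to the zero ideal. Adic closedness of these ideals replaces finiteness of `N`. -/
theorem linearIndependent_of_irrelevantIdeal {k N ι : Type*} [Field k] [AddCommGroup N]
    [Module (MvPolynomial (Fin 3) k) N]
    (hN : IsWeaklyRegularTriple (X 0 : MvPolynomial (Fin 3) k) (X 1) (X 2) N) {g : ι → N}
    (hg : ∀ c : ι →₀ MvPolynomial (Fin 3) k, Finsupp.linearCombination _ g c ∈
      irrelevantIdeal k 3 • (⊤ : Submodule (MvPolynomial (Fin 3) k) N) →
      ∀ i, c i ∈ irrelevantIdeal k 3) :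
    LinearIndependent (MvPolynomial (Fin 3) k) g := by
  have mem₁ {v : N} : v ∈ Ideal.span {(X 0 : MvPolynomial (Fin 3) k)} •
      (⊤ : Submodule (MvPolynomial (Fin 3) k) N) ↔ ∃ a, v = (X 0 : MvPolynomial (Fin 3) k) • a := by
    have := Submodule.mem_span_pair_smul_top (x := (X 0 : MvPolynomial (Fin 3) k)) (y := 0) (v := v)
    simpa [Ideal.span_pair_zero] using this
  have closed (s : Set (Fin 3)) (j : Fin 3) (p : MvPolynomial (Fin 3) k) :=
    mem_span_X_image_of_forall_pow (s := s) (j := j) (p := p)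
  have h₂ := mem_of_linearCombination_mem_smul_top
    (J := Ideal.span {(X 0 : MvPolynomial (Fin 3) k), X 1}) (x := X 2) (g := g)
    (fun v hv => by
      obtain ⟨a, b, hab⟩ := Submodule.mem_span_pair_smul_top.1 hv
      exact Submodule.mem_span_pair_smul_top.2 (hN.third _ _ _ hab))
    (fun p => by simpa [Set.image_pair] using closed {0, 1} 2 p)
    (by rwa [← irrelevantIdeal_three])
  have h₁ := mem_of_linearCombination_mem_smul_top
    (J := Ideal.span {(X 0 : MvPolynomial (Fin 3) k)}) (x := X 1) (g := g)
    (fun v hv => by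
      obtain ⟨a, ha⟩ := mem₁.1 hv
      exact mem₁.2 (hN.second _ _ ha))
    (fun p => by simpa using closed {0} 1 p)
    (by rwa [← Ideal.span_insert, Set.pair_comm, Set.pair_comm])
  have h₀ := mem_of_linearCombination_mem_smul_top
    (J := (⊥ : Ideal (MvPolynomial (Fin 3) k))) (x := X 0) (g := g)
    (fun v hv => by
      rw [Submodule.bot_smul, Submodule.mem_bot] at hv ⊢
      exact hN.first _ hv)
    (fun p => by simpa using closed ∅ 0 p)
    (by rwa [bot_sup_eq])
  rw [linearIndependent_iff]
  intro c hc
  exact Finsupp.ext fun i => h₀ c (by rw [hc]; exact zero_mem _) i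

/-! ### Graded Nakayama and homogeneous bases -/

section Graded

variable {k : Type} [Field k] {r m : ℕ}

/-- Graded Nakayama: homogeneous vectors generating `N` modulo `𝔪 N` generate `N`. -/
theorem le_span_of_le_sup_irrelevantIdeal_smul
    {N : Submodule (MvPolynomial (Fin r) k) (Fin m → MvPolynomial (Fin r) k)}
    {s : Set (Fin m → MvPolynomial (Fin r) k)}
    (hs : ∀ v ∈ s, ∃ e, ∀ j, (v j).IsHomogeneous e)
    (h : ∀ v ∈ N, ∃ w ∈ Submodule.span k s, v - w ∈ irrelevantIdeal k r • N) :
    N ≤ Submodule.span (MvPolynomial (Fin r) k) s := by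
  set S := Submodule.span (MvPolynomial (Fin r) k) s
  have hsS (e : ℕ) (w) (hw : w ∈ Submodule.span k s) : vectorComponent k r m e w ∈ S := by
    induction hw using Submodule.span_induction with
    | mem v hv =>
      obtain ⟨d, hd⟩ := hs v hv
      have : vectorComponent k r m e v = if e = d then v else 0 := by
        funext j
        rw [vectorComponent_apply, homogeneousComponent_of_mem (hd j)]
        split_ifs <;> rfl
      rw [this]
      split_ifs
      · exact Submodule.subset_span hv
      · exact zero_mem _
    | zero => rw [map_zero]; exact zero_mem _
    | add u v _ _ hu hv => rw [map_add]; exact add_mem hu hv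
    | smul a v _ hv => rw [map_smul]; exact Submodule.smul_of_tower_mem S a hv
  -- Induction on degree replaces finite generation: a component of degree `e + 1` of an element of
  -- `𝔪 N` is built from variables times degree `e` components of elements of `N`.
  have key (e : ℕ) : ∀ v ∈ N, vectorComponent k r m e v ∈ S := by
    induction e with
    | zero =>
      intro v hv
      obtain ⟨w, hw, hvw⟩ := h v hv
      rw [← sub_add_cancel v w, map_add]
      refine add_mem ?_ (hsS 0 w hw)
      have : vectorComponent k r m 0 (v - w) = 0 := by
        generalize v - w = u at hvw
        induction hvw using Submodule.smul_induction_on' with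
        | smul p hp n hn =>
          rw [irrelevantIdeal_eq_ker, RingHom.mem_ker, constantCoeff_eq] at hp
          funext j
          rw [vectorComponent_apply, homogeneousComponent_zero, ← constantCoeff_eq, Pi.smul_apply,
            smul_eq_mul, map_mul, constantCoeff_eq, hp, zero_mul, C_0]
          rfl
        | add u _ v _ hu hv => rw [map_add, hu, hv, add_zero]
      rw [this]
      exact zero_mem _
    | succ e ih =>
      intro v hv
      obtain ⟨w, hw, hvw⟩ := h v hv
      rw [← sub_add_cancel v w, map_add]
      refine add_mem ?_ (hsS (e + 1) w hw)
      have hmul (p : MvPolynomial (Fin r) k) (hp : p ∈ irrelevantIdeal k r) :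
          ∀ n ∈ N, vectorComponent k r m (e + 1) (p • n) ∈ S := by
        induction hp using Submodule.span_induction with
        | mem p hp =>
          obtain ⟨i, rfl⟩ := hp
          intro n hn
          have : vectorComponent k r m (e + 1) ((X i : MvPolynomial (Fin r) k) • n) =
              (X i : MvPolynomial (Fin r) k) • vectorComponent k r m e n :=
            funext fun j => homogeneousComponent_succ_X_mul i (n j) e
          rw [this]
          exact S.smul_mem _ (ih n hn)
        | zero => intro n _; rw [zero_smul, map_zero]; exact zero_mem _
        | add p q _ _ hp hq =>
          intro n hn
          rw [add_smul, map_add]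
          exact add_mem (hp n hn) (hq n hn)
        | smul q p _ hp =>
          intro n hn
          rw [smul_assoc, smul_comm]
          exact hp _ (N.smul_mem q hn)
      generalize v - w = u at hvw
      induction hvw using Submodule.smul_induction_on' with
      | smul p hp n hn => exact hmul p hp n hn
      | add u _ v _ hu hv => rw [map_add]; exact add_mem hu hv
  intro v hv
  obtain ⟨n, hn⟩ := exists_sum_vectorComponent v
  rw [← hn]
  exact Submodule.sum_mem _ fun e _ => key e v hv

theorem isGradedFree_of_isWeaklyRegularTriple
    {N : Submodule (MvPolynomial (Fin 3) k) (Fin m → MvPolynomial (Fin 3) k)}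
    (hN : IsGradedSubmodule N)
    (hreg : IsWeaklyRegularTriple (X 0 : MvPolynomial (Fin 3) k) (X 1) (X 2) N) :
    IsGradedFree N := by
  set 𝔪 := irrelevantIdeal k 3
  let V := N ⧸ (𝔪 • ⊤ : Submodule (MvPolynomial (Fin 3) k) N)
  let π : N →ₗ[k] V := (Submodule.mkQ (𝔪 • ⊤)).restrictScalars k
  have hπ (v : N) : π v = 0 ↔ v ∈ 𝔪 • (⊤ : Submodule (MvPolynomial (Fin 3) k) N) :=
    Submodule.Quotient.mk_eq_zero _
  let H := {v : N // ∃ e, ∀ j, ((v : Fin m → MvPolynomial (Fin 3) k) j).IsHomogeneous e}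
  -- The basis of `N / 𝔪 N` is extracted from the classes of homogeneous elements, so its lifts are
  -- homogeneous.
  obtain ⟨κ, a, -, hspan, hli⟩ := exists_linearIndependent' k fun v : H => π v.1
  let g : κ → N := fun i => (a i).1
  choose deg hdeg using fun i => (a i).2
  have hindep : LinearIndependent (MvPolynomial (Fin 3) k) g := by
    refine linearIndependent_of_irrelevantIdeal hreg fun c hc i => ?_
    have h0 : Finsupp.linearCombination k ((fun v : H => π v.1) ∘ a)
        (c.mapRange constantCoeff (map_zero _)) = 0 := by
      have hsub : Finsupp.linearCombination _ g c -
          ∑ i ∈ c.support, (C (constantCoeff (c i)) : MvPolynomial (Fin 3) k) • g i ∈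
          𝔪 • (⊤ : Submodule (MvPolynomial (Fin 3) k) N) := by
        rw [Finsupp.linearCombination_apply, Finsupp.sum, ← Finset.sum_sub_distrib]
        refine Submodule.sum_mem _ fun i _ => ?_
        rw [← sub_smul]
        exact Submodule.smul_mem_smul (sub_C_constantCoeff_mem_irrelevantIdeal _) trivial
      have := (hπ _).2 (by simpa using Submodule.sub_mem _ hc hsub)
      rw [map_sum] at this
      rw [Finsupp.linearCombination_apply, Finsupp.sum_mapRange_index (by simp), Finsupp.sum,
        ← this]
      refine Finset.sum_congr rfl fun i _ => ?_
      rw [← algebraMap_eq, algebraMap_smul, map_smul]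
      rfl
    rw [irrelevantIdeal_eq_ker, RingHom.mem_ker]
    exact DFunLike.congr_fun (linearIndependent_iff.1 hli _ h0) i
  let s : Set (Fin m → MvPolynomial (Fin 3) k) := Set.range fun i => (g i : Fin m → _)
  have hgen : N ≤ Submodule.span (MvPolynomial (Fin 3) k) s := by
    refine le_span_of_le_sup_irrelevantIdeal_smul ?_ fun v hv => ?_
    · rintro _ ⟨i, rfl⟩
      exact ⟨deg i, hdeg i⟩
    · have hV : ∀ v : N, π v ∈ Submodule.span k (Set.range fun v : H => π v.1) := by
        intro v
        obtain ⟨n, hn⟩ := exists_sum_vectorComponent (v : Fin m → MvPolynomial (Fin 3) k)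
        have : v = ∑ e ∈ Finset.range n, ⟨vectorComponent k 3 m e v, hN v v.2 e⟩ :=
          Subtype.ext (by rw [AddSubmonoidClass.coe_finsetSum]; exact hn.symm)
        rw [this, map_sum]
        refine Submodule.sum_mem _ fun e _ => Submodule.subset_span ⟨⟨⟨_, hN v v.2 e⟩, e, ?_⟩, rfl⟩
        exact fun j => homogeneousComponent_isHomogeneous _ _
      have hv' := hV ⟨v, hv⟩
      rw [← hspan, show (fun v : H => π v.1) ∘ a = π ∘ g from rfl, Set.range_comp,
        Submodule.span_image] at hv'
      obtain ⟨w, hw, hwv⟩ := hv'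
      refine ⟨w, ?_, ?_⟩
      · have := Submodule.mem_map_of_mem (f := N.subtype.restrictScalars k) hw
        rw [← Submodule.span_image, ← Set.range_comp] at this
        exact this
      · have h := (hπ (⟨v, hv⟩ - w)).1 (by rw [map_sub, hwv, sub_self])
        have := Submodule.mem_map_of_mem (f := N.subtype) h
        rw [Submodule.map_smul'', Submodule.map_top, Submodule.range_subtype] at this
        exact this
  refine ⟨κ, Module.Basis.mk hindep fun v _ => ?_, deg, fun i j => ?_⟩
  · have := hgen v.2
    rw [show s = N.subtype '' Set.range g from (Set.range_comp N.subtype g), Submodule.span_image]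
      at this
    obtain ⟨w, hw, hwv⟩ := this
    rwa [Subtype.ext hwv] at hw
  · rw [Module.Basis.mk_apply]
    exact hdeg i j

end Graded

/-! ### Dimension shifting -/

section ProjectiveDimension

open CategoryTheory

universe u

variable {R M P : Type u} [CommRing R] [AddCommGroup M] [Module R M] [AddCommGroup P] [Module R P]

theorem hasProjectiveDimensionLT_two_quotient_iff [Module.Projective R P] (I : Submodule R P) :
    HasProjectiveDimensionLT (ModuleCat.of R (P ⧸ I)) 2 ↔ Module.Projective R I := by
  have hS := LinearMap.shortExact_shortComplexKer I.mkQ_surjective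
  have hP : Projective (ModuleCat.of R P) := (IsProjective.iff_projective P).1 inferInstance
  refine (hS.hasProjectiveDimensionLT_X₃_iff 0 hP).trans ?_
  rw [zero_add, ← projective_iff_hasProjectiveDimensionLT_one]
  refine (IsProjective.iff_projective (LinearMap.ker I.mkQ)).symm.trans ?_
  rw [Submodule.ker_mkQ]

theorem hasProjectiveDimensionLT_three_quotient_range_iff [Module.Projective R M]
    [Module.Projective R P] (φ : M →ₗ[R] P) :
    HasProjectiveDimensionLT (ModuleCat.of R (P ⧸ LinearMap.range φ)) 3 ↔
      Module.Projective R (LinearMap.ker φ) := by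
  have hS := LinearMap.shortExact_shortComplexKer (LinearMap.range φ).mkQ_surjective
  have hP : Projective (ModuleCat.of R P) := (IsProjective.iff_projective P).1 inferInstance
  refine (hS.hasProjectiveDimensionLT_X₃_iff 1 hP).trans ?_
  have hker : LinearMap.ker (LinearMap.range φ).mkQ = LinearMap.range φ := Submodule.ker_mkQ _
  let ψ : M →ₗ[R] LinearMap.ker (LinearMap.range φ).mkQ :=
    φ.codRestrict _ fun x => by rw [hker]; exact ⟨x, rfl⟩
  have hψ : Function.Surjective ψ := by
    rintro ⟨y, hy⟩
    rw [hker] at hy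
    obtain ⟨x, rfl⟩ := hy
    exact ⟨x, rfl⟩
  have hM : Projective (ModuleCat.of R M) := (IsProjective.iff_projective M).1 inferInstance
  refine ((LinearMap.shortExact_shortComplexKer hψ).hasProjectiveDimensionLT_X₃_iff 0 hM).trans ?_
  rw [zero_add, ← projective_iff_hasProjectiveDimensionLT_one]
  refine (IsProjective.iff_projective (LinearMap.ker ψ)).symm.trans ?_
  rw [LinearMap.ker_codRestrict]

end ProjectiveDimension

/-! ### Projective ideals in factorial domains -/

theorem UniqueFactorizationMonoid.dvd_of_forall_dvd_mul {R ι : Type*} [CommRing R] [IsDomain R]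
    [UniqueFactorizationMonoid R] [Fintype ι] {f : ι → R}
    (hf : ∀ g, (∀ i, g ∣ f i) → IsUnit g) {a c : R} (h : ∀ i, a ∣ f i * c) : a ∣ c := by
  classical
  obtain ⟨hR⟩ : Nonempty (NormalizedGCDMonoid R) := inferInstance
  have h₁ : a ∣ Finset.univ.gcd fun i => f i * c := Finset.dvd_gcd fun i _ => h i
  rw [(Finset.gcd_mul_right' Finset.univ f c).dvd_iff_dvd_right] at h₁
  exact (hf _ fun i => Finset.gcd_dvd (Finset.mem_univ i)).dvd_mul_left.1 h₁

/-- An ideal of a factorial domain generated by elements without a common factor is projective only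
if it is the unit ideal. -/
theorem range_linearCombination_eq_top_of_projective {R : Type*} [CommRing R] [IsDomain R]
    [UniqueFactorizationMonoid R] {m : ℕ} {f : Fin m → R}
    (hf : ∀ g, (∀ i, g ∣ f i) → IsUnit g)
    [Module.Projective R (LinearMap.range (Fintype.linearCombination R f))] :
    LinearMap.range (Fintype.linearCombination R f) = ⊤ := by
  set φ := Fintype.linearCombination R f
  obtain ⟨σ, hσ⟩ := Module.projective_lifting_property φ.rangeRestrict .id
    φ.surjective_rangeRestrict
  have hσ' (x : LinearMap.range φ) : φ (σ x) = x := congrArg Subtype.val (LinearMap.congr_fun hσ x)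
  have hmem (i : Fin m) : f i ∈ LinearMap.range φ :=
    ⟨Pi.single i 1, by simp [φ, Fintype.linearCombination_apply_single]⟩
  obtain ⟨i, hi⟩ : ∃ i, f i ≠ 0 := by
    by_contra! h
    exact not_isUnit_zero (hf 0 fun i => by rw [h i])
  -- Linearity gives `f l • σ (f i) = f i • σ (f l)` for all `l`, so coprimality makes `f i` divide
  -- `σ (f i)`. Dividing `φ (σ (f i)) = f i` by `f i` then puts 1 in the range.
  have hdvd (j : Fin m) : f i ∣ σ ⟨f i, hmem i⟩ j := by
    refine UniqueFactorizationMonoid.dvd_of_forall_dvd_mul hf fun l => ⟨σ ⟨f l, hmem l⟩ j, ?_⟩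
    have : f l • (⟨f i, hmem i⟩ : LinearMap.range φ) = f i • ⟨f l, hmem l⟩ :=
      Subtype.ext (mul_comm _ _)
    have := congrArg σ this
    rw [map_smul, map_smul] at this
    exact congrFun this j
  choose c hc using hdvd
  have h := hσ' ⟨f i, hmem i⟩
  rw [show σ ⟨f i, hmem i⟩ = f i • c from funext hc, map_smul, smul_eq_mul] at h
  have h1 : φ c = 1 := mul_left_cancel₀ hi (by rw [h, mul_one])
  exact (Ideal.eq_top_iff_one _).2 ⟨c, h1⟩

/-! ### Saturation and associated primes -/

theorem isSaturated_iff {k : Type*} [Field k] {r : ℕ} {I : Ideal (MvPolynomial (Fin r) k)} :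
    IsSaturated I ↔ ∀ f, (∀ i, X i * f ∈ I) → f ∈ I := by
  constructor
  · intro h f hf
    refine h f ⟨1, fun g hg => ?_⟩
    rw [pow_one] at hg
    induction hg using Submodule.span_induction with
    | mem p hp => obtain ⟨i, rfl⟩ := hp; exact hf i
    | zero => rw [zero_mul]; exact zero_mem _
    | add p q _ _ hp hq => rw [add_mul]; exact add_mem hp hq
    | smul q p _ hp => rw [smul_mul_assoc]; exact I.smul_mem q hp
  · rintro h f ⟨e, he⟩
    induction e generalizing f with
    | zero => simpa using he 1 (by simp)
    | succ e ih =>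
      refine h f fun i => ih _ fun g hg => ?_
      rw [← mul_assoc]
      exact he _ (by rw [pow_succ]; exact Ideal.mul_mem_mul hg (X_mem_irrelevantIdeal i))

theorem irrelevantIdeal_notMem_associatedPrimes_iff {k : Type*} [Field k] {r : ℕ}
    {I : Ideal (MvPolynomial (Fin r) k)} :
    irrelevantIdeal k r ∉ associatedPrimes (MvPolynomial (Fin r) k) (MvPolynomial (Fin r) k ⧸ I) ↔
      ∀ f, (∀ i, X i * f ∈ I) → f ∈ I := by
  rw [AssociatedPrimes.mem_iff, isAssociatedPrime_iff, not_and]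
  have hcolon (p f : MvPolynomial (Fin r) k) :
      p ∈ (⊥ : Submodule (MvPolynomial (Fin r) k) (MvPolynomial (Fin r) k ⧸ I)).colon
        {Ideal.Quotient.mk I f} ↔ p * f ∈ I := by
    rw [Submodule.mem_colon_singleton, Submodule.mem_bot, ← Ideal.Quotient.eq_zero_iff_mem]
    rfl
  constructor
  · intro h f hf
    by_contra hfI
    refine h inferInstance ⟨Ideal.Quotient.mk I f, ?_⟩
    refine Ideal.IsMaximal.eq_of_le inferInstance ?_ ?_
    · rw [Ne, Ideal.eq_top_iff_one, hcolon, one_mul]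
      exact hfI
    · rw [irrelevantIdeal, Ideal.span_le]
      rintro _ ⟨i, rfl⟩
      exact (hcolon _ _).2 (hf i)
  · rintro h - ⟨x, hx⟩
    obtain ⟨f, rfl⟩ := Ideal.Quotient.mk_surjective x
    have hf := h f fun i => (hcolon _ _).1 (hx ▸ X_mem_irrelevantIdeal i)
    have : (1 : MvPolynomial (Fin r) k) ∈ irrelevantIdeal k r := by
      rw [hx, hcolon, one_mul]
      exact hf
    exact Ideal.IsPrime.ne_top inferInstance ((Ideal.eq_top_iff_one _).2 this)

/-! ### Depth and height -/

/-- After localizing at `P` the sequence stays regular, and each of its elements lowers the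
dimension by one; the final quotient has nonnegative dimension. -/
theorem idealDepth_le_height {A : Type*} [CommRing A] [IsNoetherianRing A] (P : Ideal A)
    [P.IsPrime] : idealDepth P ≤ P.height := by
  refine iSup_le fun rs => iSup_le fun hrs => iSup_le fun hP => ?_
  have h := ringKrullDim_add_length_eq_ringKrullDim_of_isRegular _
    (hrs.toIsWeaklyRegular.isRegular_of_isLocalization_of_mem (Localization.AtPrime P) P hP)
  rw [IsLocalization.AtPrime.ringKrullDim_eq_height P (Localization.AtPrime P), List.length_map] at h
  set d := ringKrullDim
    (Localization.AtPrime P ⧸ Ideal.ofList (rs.map (algebraMap A (Localization.AtPrime P))))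
  have hd : 0 ≤ d := by
    by_contra! hd
    have : d = ⊥ := by
      by_contra hne
      obtain ⟨c, hc⟩ := WithBot.ne_bot_iff_exists.1 hne
      rw [← hc] at hd
      exact absurd hd (not_lt.2 (WithBot.coe_le_coe.2 (zero_le (a := c))))
    rw [this, WithBot.bot_add] at h
    exact WithBot.bot_ne_coe h
  have : ((rs.length : ℕ∞) : WithBot ℕ∞) ≤ (P.height : WithBot ℕ∞) := by
    rw [← h]
    exact le_add_of_nonneg_left hd
  exact WithBot.coe_le_coe.1 this

theorem one_le_idealDepth_iff {A : Type*} [CommRing A] {P : Ideal A} (hP : P ≠ ⊤) :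
    1 ≤ idealDepth P ↔ ∃ x ∈ P, IsSMulRegular A x := by
  constructor
  · intro h
    by_contra! hcon
    refine absurd h (not_le.2 (lt_of_le_of_lt (b := 0) ?_ one_pos))
    refine iSup_le fun rs => iSup_le fun hrs => iSup_le fun hmem => ?_
    match rs, hrs, hmem with
    | [], _, _ => simp
    | x :: rs, hrs, hmem =>
      exact absurd ((RingTheory.Sequence.isRegular_cons_iff _ _ _).1 hrs).1
        (hcon x (hmem x List.mem_cons_self))
  · rintro ⟨x, hx, hreg⟩
    refine le_trans (by simp) (le_iSup_of_le [x] (le_iSup_of_le ?_ (le_iSup_of_le ?_ le_rfl)))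
    · refine ⟨(RingTheory.Sequence.isWeaklyRegular_singleton_iff A x).2 hreg, fun h => hP ?_⟩
      rw [smul_eq_mul, Ideal.mul_top, Ideal.ofList_singleton] at h
      exact top_le_iff.1 (h.le.trans ((Ideal.span_singleton_le_iff_mem P).2 hx))
    · simpa using hx

/-- A prime element `g` of `p` gives the chain `0 < (g) < p`; equality at the top would make `g` a
common factor. -/
theorem two_le_height_of_forall_mem {R ι : Type*} [CommRing R] [IsDomain R]
    [UniqueFactorizationMonoid R] {f : ι → R} (hf : ∀ g, (∀ i, g ∣ f i) → IsUnit g)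
    {p : Ideal R} [p.IsPrime] (hp : ∀ i, f i ∈ p) : 2 ≤ p.height := by
  obtain ⟨i, hi⟩ : ∃ i, f i ≠ 0 := by
    by_contra! h
    exact not_isUnit_zero (hf 0 fun i => by rw [h i])
  obtain ⟨g, hgp, hg⟩ := Ideal.IsPrime.exists_mem_prime_of_ne_bot (I := p) inferInstance
    (fun h => hi (by simpa [h] using hp i))
  have : (Ideal.span {g}).IsPrime := (Ideal.span_singleton_prime hg.ne_zero).2 hg
  have hlt : Ideal.span {g} < p := by
    refine lt_of_le_of_ne ((Ideal.span_singleton_le_iff_mem p).2 hgp) fun e => hg.not_isUnit ?_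
    exact hf g fun i => Ideal.mem_span_singleton.1 (e ▸ hp i)
  have h0 : (⊥ : Ideal R) < Ideal.span {g} :=
    bot_lt_iff_ne_bot.2 fun e => hg.ne_zero (Ideal.span_singleton_eq_bot.1 e)
  have h₁ := Ideal.height_add_one_le_of_lt_of_isPrime h0
  have h₂ := Ideal.height_add_one_le_of_lt_of_isPrime hlt
  calc (2 : ℕ∞) = 0 + 1 + 1 := by norm_num
    _ ≤ (⊥ : Ideal R).height + 1 + 1 := by gcongr; exact zero_le
    _ ≤ p.height := le_trans (by gcongr) h₂

theorem comap_lt_comap_quotientMk {R : Type*} [CommRing R] {I : Ideal R} {p q : Ideal (R ⧸ I)}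
    (h : p < q) : p.comap (Ideal.Quotient.mk I) < q.comap (Ideal.Quotient.mk I) :=
  lt_of_le_of_ne (Ideal.comap_mono h.le) fun e =>
    h.ne (Ideal.comap_injective_of_surjective _ Ideal.Quotient.mk_surjective e)

/-- A prime ideal of the quotient of a three-dimensional factorial domain by elements without a
common factor has height at most one. -/
theorem height_le_one_of_quotient {R ι : Type*} [CommRing R] [IsDomain R]
    [UniqueFactorizationMonoid R] (hR : ringKrullDim R ≤ 3) {f : ι → R}
    (hf : ∀ g, (∀ i, g ∣ f i) → IsUnit g) {I : Ideal R} (hI : ∀ i, f i ∈ I) (P : Ideal (R ⧸ I))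
    [P.IsPrime] : P.height ≤ 1 := by
  have hle : ∀ q : Ideal (R ⧸ I), I ≤ q.comap (Ideal.Quotient.mk I) := fun q x hx => by
    rw [Ideal.mem_comap, Ideal.Quotient.eq_zero_iff_mem.2 hx]; exact zero_mem _
  rw [← Nat.cast_one, Ideal.height_le_iff]
  intro q _ hqP
  rw [Nat.cast_one, Order.lt_one_iff, ← nonpos_iff_eq_zero, ← Nat.cast_zero,
    Ideal.height_le_iff]
  intro q' _ hq'
  -- A chain `q' < q < P` would pull back to primes of heights at least 2, 3 and 4.
  have h₀ : 2 ≤ (q'.comap (Ideal.Quotient.mk I)).height :=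
    two_le_height_of_forall_mem hf fun i => hle q' (hI i)
  have h₁ := Ideal.height_add_one_le_of_lt_of_isPrime (comap_lt_comap_quotientMk hq')
  have h₂ := Ideal.height_add_one_le_of_lt_of_isPrime (comap_lt_comap_quotientMk hqP)
  have h₃ : (P.comap (Ideal.Quotient.mk I)).height ≤ 3 := by
    have := (Ideal.height_le_ringKrullDim_of_isPrime
      (I := P.comap (Ideal.Quotient.mk I))).trans hR
    exact (WithBot.coe_le_coe (b := 3)).1 this
  have h₄ : (2 : ℕ∞) + 1 + 1 ≤ 3 :=
    (add_le_add_left ((add_le_add_left h₀ 1).trans h₁) 1).trans (h₂.trans h₃)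
  exact absurd h₄ (by decide)

/-! ### Homogeneous ideals and lines through the origin -/

namespace MvPolynomial

variable {σ k : Type*} [Field k]

theorem homogeneousComponent_mem_span {ι : Type*} {f : ι → MvPolynomial σ k} {n : ℕ}
    (hf : ∀ i, (f i).IsHomogeneous n) {p : MvPolynomial σ k}
    (hp : p ∈ Ideal.span (Set.range f)) (e : ℕ) :
    homogeneousComponent e p ∈ Ideal.span (Set.range f) := by
  let _ := MvPolynomial.gradedAlgebra (σ := σ) (R := k)
  refine homogeneousComponent_mem_of_mem (Ideal.homogeneous_span _ _ ?_) hp e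
  rintro _ ⟨i, rfl⟩
  exact ⟨n, hf i⟩

/-- If `I` contains the homogeneous components of its elements and `α ≠ 0`, then `X i - α` is
regular modulo `I`. -/
theorem mem_of_X_sub_C_mul_mem {I : Ideal (MvPolynomial σ k)}
    (hI : ∀ p ∈ I, ∀ e, homogeneousComponent e p ∈ I) {i : σ} {α : k} (hα : α ≠ 0)
    {f : MvPolynomial σ k} (h : (X i - C α) * f ∈ I) : f ∈ I := by
  have hC {g : MvPolynomial σ k} (hg : C α * g ∈ I) : g ∈ I := by
    have := I.mul_mem_left (C α⁻¹) hg
    rwa [← mul_assoc, ← C_mul, inv_mul_cancel₀ hα, C_1, one_mul] at this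
  -- In degree `e + 1` the product has component `X i * f_e - α * f_(e+1)`, so membership propagates
  -- upwards from degree 0.
  have key (e : ℕ) : homogeneousComponent e f ∈ I := by
    induction e with
    | zero =>
      have := hI _ h 0
      rw [sub_mul, map_sub, homogeneousComponent_zero_X_mul, homogeneousComponent_C_mul, zero_sub,
        neg_mem_iff] at this
      exact hC this
    | succ e ih =>
      have := hI _ h (e + 1)
      rw [sub_mul, map_sub, homogeneousComponent_succ_X_mul, homogeneousComponent_C_mul] at this
      exact hC (by simpa using sub_mem (I.mul_mem_left (X i) ih) this)
  rw [← sum_homogeneousComponent f]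
  exact sum_mem fun e _ => key e

/-- The prime ideal of polynomials vanishing on the line through the origin and `p`. -/
def lineIdeal (p : σ → k) : Ideal (MvPolynomial σ k) :=
  RingHom.ker (aeval fun i => Polynomial.C (p i) * Polynomial.X :
    MvPolynomial σ k →ₐ[k] Polynomial k)

instance (p : σ → k) : (lineIdeal p).IsPrime := RingHom.ker_isPrime _

theorem mem_lineIdeal_of_isHomogeneous {p : σ → k} {f : MvPolynomial σ k} {n : ℕ}
    (hf : f.IsHomogeneous n) (h : eval p f = 0) : f ∈ lineIdeal p := by
  rw [lineIdeal, RingHom.mem_ker]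
  have e : aeval (fun i => Polynomial.C (p i) * Polynomial.X) f =
      Polynomial.C (eval p f) * Polynomial.X ^ n := by
    rw [f.as_sum, map_sum, map_sum, map_sum, Finset.sum_mul]
    refine Finset.sum_congr rfl fun d hd => ?_
    have hdeg : d.degree = n := by
      rw [Finsupp.degree_eq_weight_one]; exact hf (mem_support_iff.1 hd)
    rw [aeval_monomial, eval_monomial, ← hdeg]
    simp only [Finsupp.prod, mul_pow, Finset.prod_mul_distrib, map_mul, map_prod, map_pow,
      Finset.prod_pow_eq_pow_sum, Finsupp.degree_apply, Polynomial.algebraMap_eq, mul_assoc]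
  change aeval _ f = 0
  rw [e, h, Polynomial.C_0, zero_mul]

end MvPolynomial

theorem lineIdeal_lt_irrelevantIdeal {k : Type*} [Field k] {r : ℕ} {p : Fin r → k} (hp : p ≠ 0) :
    lineIdeal p < irrelevantIdeal k r := by
  obtain ⟨i, hi⟩ := Function.ne_iff.1 hp
  refine SetLike.lt_iff_le_and_exists.2 ⟨fun f hf => ?_, X i, X_mem_irrelevantIdeal i, fun h => ?_⟩
  · rw [irrelevantIdeal_eq_ker, RingHom.mem_ker]
    have h0 : (Polynomial.aeval (0 : k)).comp
        (aeval fun i => Polynomial.C (p i) * Polynomial.X) = aeval (fun _ : Fin r => (0 : k)) := by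
      ext; simp
    have h1 := DFunLike.congr_fun h0 f
    rw [AlgHom.comp_apply, show aeval (fun i => Polynomial.C (p i) * Polynomial.X) f = 0 from hf,
      map_zero] at h1
    simpa using h1.symm
  · have h' : aeval (fun i => Polynomial.C (p i) * Polynomial.X) (X i : MvPolynomial (Fin r) k) = 0 :=
      h
    rw [aeval_X] at h'
    simp at h'
    exact hi h'

theorem isSMulRegular_quotient_iff {R : Type*} [CommRing R] {I : Ideal R} {x : R} :
    IsSMulRegular (R ⧸ I) (Ideal.Quotient.mk I x) ↔ ∀ g, x * g ∈ I → g ∈ I := by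
  rw [isSMulRegular_iff_right_eq_zero_of_smul, Ideal.Quotient.mk_surjective.forall]
  refine forall_congr' fun g => ?_
  rw [smul_eq_mul, ← map_mul, Ideal.Quotient.eq_zero_iff_mem, Ideal.Quotient.eq_zero_iff_mem]

/-! ### The Cohen–Macaulay condition -/

section CohenMacaulay

variable {k : Type*} [Field k] {m : ℕ} {f : Fin m → MvPolynomial (Fin 3) k}

/-- Prime avoidance: if `𝔪` consisted of zero divisors, it would lie in one of the finitely many
associated primes, and equal it by maximality. -/
theorem exists_mem_irrelevantIdeal_regular {r : ℕ} {I : Ideal (MvPolynomial (Fin r) k)}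
    (h : irrelevantIdeal k r ∉
      associatedPrimes (MvPolynomial (Fin r) k) (MvPolynomial (Fin r) k ⧸ I)) :
    ∃ x ∈ irrelevantIdeal k r, ∀ g, x * g ∈ I → g ∈ I := by
  by_contra! hcon
  have hsub : (irrelevantIdeal k r : Set (MvPolynomial (Fin r) k)) ⊆
      ⋃ p ∈ associatedPrimes (MvPolynomial (Fin r) k) (MvPolynomial (Fin r) k ⧸ I),
        ((id p : Ideal (MvPolynomial (Fin r) k)) : Set (MvPolynomial (Fin r) k)) := by
    intro x hx
    obtain ⟨g, hxg, hg⟩ := hcon x hx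
    have := biUnion_associatedPrimes_eq_zero_divisors (MvPolynomial (Fin r) k)
      (MvPolynomial (Fin r) k ⧸ I)
    simp only [id]
    rw [this]
    exact ⟨Ideal.Quotient.mk I g, fun e => hg (Ideal.Quotient.eq_zero_iff_mem.1 e),
      Ideal.Quotient.eq_zero_iff_mem.2 hxg⟩
  obtain ⟨p, hp, hle⟩ := (Ideal.subset_union_prime_finite (associatedPrimes.finite _ _)
    (f := id) 0 0 fun _ h _ _ => h.1).1 hsub
  have hpp : p.IsPrime := hp.1
  exact h ((Ideal.IsMaximal.eq_of_le inferInstance hpp.ne_top hle) ▸ hp)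

theorem isCohenMacaulay_quotient [IsAlgClosed k] {n : ℕ} (hhom : ∀ i, (f i).IsHomogeneous n)
    (hf : ∀ g, (∀ i, g ∣ f i) → IsUnit g)
    (h : irrelevantIdeal k 3 ∉ associatedPrimes (MvPolynomial (Fin 3) k)
      (MvPolynomial (Fin 3) k ⧸ Ideal.span (Set.range f))) :
    IsCohenMacaulay (MvPolynomial (Fin 3) k ⧸ Ideal.span (Set.range f)) := by
  refine ⟨inferInstance, fun P hP => le_antisymm (idealDepth_le_height P) ?_⟩
  have hdim : ringKrullDim (MvPolynomial (Fin 3) k) ≤ 3 := by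
    rw [MvPolynomial.ringKrullDim_of_isNoetherianRing]
    simp
  refine (height_le_one_of_quotient hdim hf (fun i => Ideal.subset_span (Set.mem_range_self i)) P).trans ?_
  rw [one_le_idealDepth_iff hP.ne_top]
  suffices H : ∃ x ∈ P.comap (Ideal.Quotient.mk _), ∀ g, x * g ∈ Ideal.span (Set.range f) →
      g ∈ Ideal.span (Set.range f) by
    obtain ⟨x, hx, hreg⟩ := H
    exact ⟨_, hx, isSMulRegular_quotient_iff.2 hreg⟩
  -- By the Nullstellensatz the maximal ideal is a point `p`; only the origin needs the hypothesis
  -- on associated primes.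
  obtain ⟨p, hp⟩ := eq_vanishingIdeal_singleton_of_isMaximal k
    (Ideal.comap_isMaximal_of_surjective _ Ideal.Quotient.mk_surjective (K := P))
  rw [hp]
  by_cases hp0 : p = 0
  · obtain ⟨x, hx, hreg⟩ := exists_mem_irrelevantIdeal_regular h
    refine ⟨x, ?_, hreg⟩
    rw [irrelevantIdeal_eq_ker, RingHom.mem_ker] at hx
    rw [mem_vanishingIdeal_singleton_iff, hp0]
    simpa using hx
  · obtain ⟨i, hi⟩ := Function.ne_iff.1 hp0
    refine ⟨X i - C (p i), ?_, fun g hg => mem_of_X_sub_C_mul_mem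
      (fun q hq e => homogeneousComponent_mem_span hhom hq e) hi hg⟩
    rw [mem_vanishingIdeal_singleton_iff]
    simp

/-- The line through `p` is a prime strictly below `𝔪` and containing the ideal, so the height of
`𝔪` in the quotient is positive. Equal depth gives an element of `𝔪` regular on the quotient, and it
already multiplies `g` into the ideal. -/
theorem mem_of_forall_X_mul_mem_of_isCohenMacaulay {n : ℕ} (hhom : ∀ i, (f i).IsHomogeneous n)
    {p : Fin 3 → k} (hp0 : p ≠ 0) (hp : ∀ i, eval p (f i) = 0)
    (h : IsCohenMacaulay (MvPolynomial (Fin 3) k ⧸ Ideal.span (Set.range f)))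
    {g : MvPolynomial (Fin 3) k} (hg : ∀ i, X i * g ∈ Ideal.span (Set.range f)) :
    g ∈ Ideal.span (Set.range f) := by
  set I := Ideal.span (Set.range f)
  have hIL : I ≤ lineIdeal p := by
    rw [Ideal.span_le]
    rintro _ ⟨i, rfl⟩
    exact mem_lineIdeal_of_isHomogeneous (hhom i) (hp i)
  have hlt := lineIdeal_lt_irrelevantIdeal hp0
  have hcomap {J : Ideal (MvPolynomial (Fin 3) k)} (hJ : I ≤ J) :
      (J.map (Ideal.Quotient.mk I)).comap (Ideal.Quotient.mk I) = J :=
    Ideal.comap_map_mk hJ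
  have hker {J : Ideal (MvPolynomial (Fin 3) k)} (hJ : I ≤ J) :
      RingHom.ker (Ideal.Quotient.mk I) ≤ J := by rwa [Ideal.mk_ker]
  set P := (irrelevantIdeal k 3).map (Ideal.Quotient.mk I)
  have hP : P.IsMaximal := by
    refine (Ideal.map_eq_top_or_isMaximal_of_surjective _ Ideal.Quotient.mk_surjective
      inferInstance).resolve_left fun e => ?_
    have := hcomap (hIL.trans hlt.le)
    rw [e, Ideal.comap_top] at this
    exact Ideal.IsPrime.ne_top (I := irrelevantIdeal k 3) inferInstance this.symm
  have hQ : ((lineIdeal p).map (Ideal.Quotient.mk I)).IsPrime :=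
    Ideal.map_isPrime_of_surjective Ideal.Quotient.mk_surjective (hker hIL)
  have hQP : (lineIdeal p).map (Ideal.Quotient.mk I) < P := by
    refine lt_of_le_of_ne (Ideal.map_mono hlt.le) fun e => hlt.ne ?_
    rw [← hcomap hIL, e, hcomap (hIL.trans hlt.le)]
  have h1 : 1 ≤ idealDepth P := by
    rw [h.depth_eq P hP]
    exact le_trans (by simp) (Ideal.height_add_one_le_of_lt_of_isPrime hQP)
  obtain ⟨x, hxP, hx⟩ := (one_le_idealDepth_iff hP.ne_top).1 h1
  obtain ⟨x, rfl⟩ := Ideal.Quotient.mk_surjective x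
  refine isSMulRegular_quotient_iff.1 hx g ?_
  have hxm : x ∈ irrelevantIdeal k 3 := by
    rw [← hcomap (hIL.trans hlt.le)]
    exact hxP
  have hle : irrelevantIdeal k 3 ≤ I.colon {g} := by
    rw [irrelevantIdeal, Ideal.span_le]
    rintro _ ⟨i, rfl⟩
    exact Submodule.mem_colon_singleton.2 (hg i)
  exact Submodule.mem_colon_singleton.1 (hle hxm)

end CohenMacaulay

/-! ### Assembling the equivalences -/

/-- The syzygies of generators of an ideal that is saturated at the irrelevant ideal form a graded
free module. -/
theorem isGradedFree_Syz {k : Type} [Field k] {m n : ℕ} {f : Fin m → MvPolynomial (Fin 3) k}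
    (hhom : ∀ i, (f i).IsHomogeneous n)
    (h : ∀ g, (∀ i, X i * g ∈ Ideal.span (Set.range f)) → g ∈ Ideal.span (Set.range f)) :
    IsGradedFree (Syz f) := by
  refine isGradedFree_of_isWeaklyRegularTriple (isGradedSubmodule_Syz hhom) ?_
  have hR := isWeaklyRegularTriple_X k
  refine (hR.pi (Fin m)).ker_of_mem_range hR fun g h0 h1 h2 => ?_
  rw [Fintype.range_linearCombination] at h0 h1 h2 ⊢
  refine h g fun i => ?_
  fin_cases i
  exacts [h0, h1, h2]

/-- An ideal is saturated as soon as the syzygy module of its generators is projective. -/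
theorem mem_span_of_projective_Syz {k : Type*} [Field k] {m : ℕ} {f : Fin m → MvPolynomial (Fin 3) k}
    [Module.Projective (MvPolynomial (Fin 3) k) (Syz f)] {g : MvPolynomial (Fin 3) k}
    (h : ∀ i, X i * g ∈ Ideal.span (Set.range f)) : g ∈ Ideal.span (Set.range f) := by
  have hR := isWeaklyRegularTriple_X k
  have hK : IsWeaklyRegularTriple (X 0 : MvPolynomial (Fin 3) k) (X 1) (X 2)
      (LinearMap.ker (Fintype.linearCombination (MvPolynomial (Fin 3) k) f)) :=
    hR.of_projective (N := Syz f)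
  have := (hR.pi (Fin m)).mem_range_of_ker hK hR.first (f := g)
  rw [Fintype.range_linearCombination] at this
  exact this (h 0) (h 1) (h 2)

theorem IsGradedFree.projective {k : Type*} [Field k] {r m : ℕ}
    {N : Submodule (MvPolynomial (Fin r) k) (Fin m → MvPolynomial (Fin r) k)}
    (h : IsGradedFree N) : Module.Projective (MvPolynomial (Fin r) k) N := by
  obtain ⟨κ, B, -⟩ := h
  exact Module.Projective.of_basis B

/-- A proper ideal generated by polynomials without a common factor has a quotient of projective
dimension two if and only if its syzygy module is projective. -/
theorem projectiveDimension_quotient_eq_two_iff {k : Type} [Field k] {r m : ℕ}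
    {f : Fin m → MvPolynomial (Fin r) k} (hf : ∀ g, (∀ i, g ∣ f i) → IsUnit g)
    (hI : Ideal.span (Set.range f) ≠ ⊤) :
    CategoryTheory.projectiveDimension (ModuleCat.of (MvPolynomial (Fin r) k)
      (MvPolynomial (Fin r) k ⧸ Ideal.span (Set.range f))) = 2 ↔
      Module.Projective (MvPolynomial (Fin r) k) (Syz f) := by
  have hrange : LinearMap.range (Fintype.linearCombination (MvPolynomial (Fin r) k) f) =
      Ideal.span (Set.range f) := Fintype.range_linearCombination _ _
  have h₃ := hasProjectiveDimensionLT_three_quotient_range_iff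
    (Fintype.linearCombination (MvPolynomial (Fin r) k) f)
  rw [hrange] at h₃
  refine Iff.trans ?_ h₃
  have h₂ : ¬ CategoryTheory.HasProjectiveDimensionLT (ModuleCat.of (MvPolynomial (Fin r) k)
      (MvPolynomial (Fin r) k ⧸ Ideal.span (Set.range f))) 2 := by
    rw [hasProjectiveDimensionLT_two_quotient_iff, ← hrange]
    intro hproj
    exact hI (hrange ▸ range_linearCombination_eq_top_of_projective hf)
  constructor
  · intro h
    exact (CategoryTheory.projectiveDimension_le_iff _ 2).1 h.le
  · intro h
    exact le_antisymm ((CategoryTheory.projectiveDimension_le_iff _ 2).2 h)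
      ((CategoryTheory.projectiveDimension_ge_iff _ 2).2 h₂)

end

theorem proposition5p2 (n : ℕ) (a b c d : MvPolynomial (Fin 3) ℂ)
    (ha : a.IsHomogeneous n) (hb : b.IsHomogeneous n)
    (hc : c.IsHomogeneous n) (hd : d.IsHomogeneous n)
    (hgcd : ∀ g : MvPolynomial (Fin 3) ℂ, g ∣ a → g ∣ b → g ∣ c → g ∣ d → IsUnit g)
    (hzero : ∃ p : Fin 3 → ℂ, p ≠ 0 ∧ MvPolynomial.eval p a = 0 ∧ MvPolynomial.eval p b = 0 ∧
      MvPolynomial.eval p c = 0 ∧ MvPolynomial.eval p d = 0)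
    (I : Ideal (MvPolynomial (Fin 3) ℂ)) (hI : I = Ideal.span {a, b, c, d}) :
    List.TFAE [
      IsGradedFree (Syz ![a, b, c, d]),
      CategoryTheory.projectiveDimension
        (ModuleCat.of (MvPolynomial (Fin 3) ℂ) (MvPolynomial (Fin 3) ℂ ⧸ I)) = 2,
      IsCohenMacaulay (MvPolynomial (Fin 3) ℂ ⧸ I),
      irrelevantIdeal ℂ 3 ∉
        associatedPrimes (MvPolynomial (Fin 3) ℂ) (MvPolynomial (Fin 3) ℂ ⧸ I),
      IsSaturated I] := by
  have hspan : I = Ideal.span (Set.range ![a, b, c, d]) := by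
    rw [hI]
    congr 1
    ext q
    simp only [Matrix.range_cons, Matrix.range_empty, Set.union_empty, Set.singleton_union]
  subst hspan
  have hhom : ∀ i, (![a, b, c, d] i).IsHomogeneous n := by
    simp [Fin.forall_fin_succ, ha, hb, hc, hd]
  have hf : ∀ g, (∀ i, g ∣ ![a, b, c, d] i) → IsUnit g :=
    fun g h => hgcd g (h 0) (h 1) (h 2) (h 3)
  obtain ⟨p, hp0, hpa, hpb, hpc, hpd⟩ := hzero
  have hp : ∀ i, MvPolynomial.eval p (![a, b, c, d] i) = 0 := by
    simp [Fin.forall_fin_succ, hpa, hpb, hpc, hpd]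
  have htop : Ideal.span (Set.range ![a, b, c, d]) ≠ ⊤ := by
    intro h
    have hle : Ideal.span (Set.range ![a, b, c, d]) ≤ RingHom.ker (MvPolynomial.eval p) := by
      rw [Ideal.span_le]
      rintro _ ⟨i, rfl⟩
      exact hp i
    exact RingHom.ker_ne_top _ (top_le_iff.1 (h ▸ hle))
  have hpd := projectiveDimension_quotient_eq_two_iff hf htop
  tfae_have 1 → 2 := fun h => hpd.2 h.projective
  tfae_have 2 → 4 := fun h => by
    have := hpd.1 h
    exact irrelevantIdeal_notMem_associatedPrimes_iff.2 fun g hg => mem_span_of_projective_Syz hg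
  tfae_have 4 → 3 := isCohenMacaulay_quotient hhom hf
  tfae_have 3 → 5 := fun h => isSaturated_iff.2 fun g hg =>
    mem_of_forall_X_mul_mem_of_isCohenMacaulay hhom hp0 hp h hg
  tfae_have 5 → 1 := fun h => isGradedFree_Syz hhom (isSaturated_iff.1 h)
  tfae_finish
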